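/- \textbf{Formulae.} $A,B ::= 0 \mid 1 \mid A\otimes B \mid A\oplus B \mid {?}A \mid \top \mid \bot \mid A\parr B \mid A\,\&\,B \mid {!}A$. The first five forms are \emph{positive}, the others \emph{negative}; $A^\perp$ is De Morgan duality ($0\leftrightarrow\top$, $1\leftrightarrow\bot$, $\otimes\leftrightarrow\parr$, $\oplus\leftrightarrow\&$, ${?}\leftrightarrow{!}$). Put $\otimes^0A=1$ and $\otimes^{n+1}A=(\otimes^nA)\otimes A$. \textbf{Positions.} A \emph{position} is a finite directed graph whose underlying undirected graph is a tree, together with a label on each edge which is a positive formula, a sign in $\{O,P\}$ for each vertex, and a selected vertex, which holds the token. Positions are considered up to isomorphism. Saying that there is an edge from $x$ to $y$ labelled by a negative formula $F$ means that there is an edge from $y$ to $x$ labelled $F^\perp$. \textbf{Moves.} Let $v$ hold the token in a position. The moves are the following; vertices keep their signs, and copies of a vertex inherit its sign. \begin{itemize} \item \emph{Negative move.} If there is an edge from $v'$ to $v$, pass the token to $v'$. \item \emph{$1$.} If there is an edge from $v$ to $v'$ labelled $1$ and it is the only edge adjacent to $v$, delete $v$ and this edge and pass the token to $v'$. \item \emph{$\oplus$.}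 If there is an edge from $v$ to $v'$ labelled $A\oplus B$, replace its label by $A$, or by $B$ (with the above convention if this is negative), and pass the token to $v'$. \item \emph{${?}$.} If there is an edge from $v$ to $v'$ labelled ${?}(A^\perp)$, replace it, for any $n\in\mathbb N$, by an edge from $v'$ to $v$ labelled $\otimes^nA$, and pass the token to $v'$. \item \emph{$\otimes$.} If there is an edge $e$ from $v$ to $v'$ labelled $A\otimes B$, let $\Delta$ be the component of $v'$ after deletion of $e$, and split the component of $v$ into three subtrees $\Gamma$, $\Theta$, $\Gamma'$ that have exactly the vertex $v$ in common pairwise, such that all edges of $\Theta$ at $v$ go out of $v$ and have labels of the form ${?}C$. The result consists of $\Delta$, of a copy $v_1$ of $v$ carrying $\Gamma$ and a copy of $\Theta$, of a copy $v_2$ of $v$ carrying $\Gamma'$ and another copy of $\Theta$, of an edge from $v_1$ to $v'$ labelled $A$, and of an edge from $v_2$ to $v'$ labelled $B$ (with the above convention if these are negative); the token is at $v'$. \end{itemize} \textbf{Plays.} A \emph{play} from a position $U$ is a finite or infinite sequence of positions that starts at $U$ and in which each position is obtained from the preceding one by a move. \textbf{Theorem.} For every position $U$, all plays from $U$ are finite.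 -/

import Mathlib

namespace LLTN

/-- Formulae of propositional linear logic without propositional variables. -/
inductive Formula : Type
  | zero : Formula
  | one : Formula
  | tensor : Formula → Formula → Formula
  | plus : Formula → Formula → Formula
  | whyNot : Formula → Formula
  | top : Formula
  | bot : Formula
  | par : Formula → Formula → Formula
  | amp : Formula → Formula → Formula
  | ofCourse : Formula → Formula

namespace Formula

/-- De Morgan duality (linear negation). -/
def dual : Formula → Formula
  | zero => top
  | one => bot
  | tensor A B => par A.dual B.dual
  | plus A B => amp A.dual B.dual
  | whyNot A => ofCourse A.dual
  | top => zero
  | bot => one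
  | par A B => tensor A.dual B.dual
  | amp A B => plus A.dual B.dual
  | ofCourse A => whyNot A.dual

/-- The positive formulae are `0`, `1`, `A ⊗ B`, `A ⊕ B` and `?A`; the others are negative. -/
def isPositive : Formula → Bool
  | zero => true
  | one => true
  | tensor _ _ => true
  | plus _ _ => true
  | whyNot _ => true
  | top => false
  | bot => false
  | par _ _ => false
  | amp _ _ => false
  | ofCourse _ => false

/-- The `n`-fold tensor power: `⊗⁰ A = 1` and `⊗ⁿ⁺¹ A = (⊗ⁿ A) ⊗ A`. -/
def tensorPow : ℕ → Formula → Formula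
  | 0, _ => one
  | n + 1, A => tensor (tensorPow n A) A

end Formula

/-- The two signs of vertices: opponents and proponents. -/
inductive Sign : Type
  | O : Sign
  | P : Sign

/-- A punctured, signed, directed graph with edges labelled by formulae: there is an edge from
`x` to `y`, with label `A`, exactly when `label x y = some A`. -/
structure Diagram : Type 1 where
  Vertex : Type
  label : Vertex → Vertex → Option Formula
  sign : Vertex → Sign
  /-- The vertex holding the token. -/
  token : Vertex

namespace Diagram

/-- The underlying undirected graph. -/
def skeleton (G : Diagram) : SimpleGraph G.Vertex :=
  SimpleGraph.fromRel fun x y => (G.label x y).isSome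

/-- `G` is a finite punctured, directed, signed, normally labelled tree. The field `oneWay` says
that there are neither loops nor two opposite edges between two vertices (these are not seen by
the simple graph `skeleton`). -/
structure IsPosition (G : Diagram) : Prop where
  finite : Finite G.Vertex
  oneWay : ∀ x y, (G.label x y).isSome → G.label y x = none
  normal : ∀ x y A, G.label x y = some A → A.isPositive = true
  tree : G.skeleton.IsTree

/-- Isomorphisms of diagrams. -/
structure Iso (G H : Diagram) where
  toEquiv : G.Vertex ≃ H.Vertex
  label_eq : ∀ x y, H.label (toEquiv x) (toEquiv y) = G.label x y
  sign_eq : ∀ x, H.sign (toEquiv x) = G.sign x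
  token_eq : toEquiv G.token = H.token

/-- Pass the token to the vertex `w`. -/
def passTo (G : Diagram) (w : G.Vertex) : Diagram :=
  { G with token := w }

open Classical in
/-- Replace whatever edge there is between `a` and `b` by one edge from `a` to `b` labelled `F`,
in normalised form: when `F` is negative, this means an edge from `b` to `a` labelled by the
dual of `F`. -/
noncomputable def setEdge (G : Diagram) (a b : G.Vertex) (F : Formula) : Diagram :=
  { G with
    label := fun x y =>
      if x = a ∧ y = b then (if F.isPositive then some F else none)
      else if x = b ∧ y = a then (if F.isPositive then none else some F.dual)
      else G.label x y }

/-- Delete the vertex holding the token, with all its edges, and give the token to `w`. -/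
def deleteActive (G : Diagram) (w : G.Vertex) (hw : w ≠ G.token) : Diagram where
  Vertex := {x : G.Vertex // x ≠ G.token}
  label := fun x y => G.label x.1 y.1
  sign := fun x => G.sign x.1
  token := ⟨w, hw⟩

/-- In the tensor move, every vertex but the active one lies in one of the subtrees `Γ`, `?Θ`,
`Γ'` (on the side of the active vertex) and `Δ` (on the side of the passive vertex). -/
inductive Part : Type
  | gamma : Part
  | theta : Part
  | gamma' : Part
  | delta : Part

/-- `part` is a legal splitting of the tree for a tensor move of the active vertex `v` on its
edge to `w`. The value of `part` at `v` is irrelevant: `v` is the common root of `Γ`, `?Θ`, `Γ'`. -/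
structure IsSplitting (G : Diagram) (w : G.Vertex) (part : G.Vertex → Part) : Prop where
  /-- Away from `v`, no edge joins two different parts. -/
  closed : ∀ x y, x ≠ G.token → y ≠ G.token → G.skeleton.Adj x y → part x = part y
  /-- Among the neighbours of `v`, exactly `w` is in `Δ`. -/
  delta_iff : ∀ x, G.skeleton.Adj G.token x → (part x = Part.delta ↔ x = w)
  /-- The edges from `v` into `?Θ` are outputs of `v` labelled by formulae `?C`. -/
  theta_whyNot : ∀ x, G.skeleton.Adj G.token x → part x = Part.theta →
    ∃ C, G.label G.token x = some (Formula.whyNot C)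

/-- The three trees from which the result of a tensor move is assembled: the one around the
first copy of the active vertex, the one around its second copy, and `Δ`. -/
inductive Zone : Type
  | first : Zone
  | second : Zone
  | opposite : Zone

/-- The vertex `x` has a copy in the given zone: the first zone is made of `v`, `Γ` and `?Θ`, the
second one of `v`, `Γ'` and `?Θ`, the opposite one of `Δ`. -/
def InZone (G : Diagram) (part : G.Vertex → Part) (x : G.Vertex) : Zone → Prop
  | Zone.first => x = G.token ∨ part x = Part.gamma ∨ part x = Part.theta
  | Zone.second => x = G.token ∨ part x = Part.gamma' ∨ part x = Part.theta
  | Zone.opposite => x ≠ G.token ∧ part x = Part.delta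

open Classical in
/-- The disjoint union of the three zones, with the token at the passive vertex `w`. -/
noncomputable def zones (G : Diagram) (part : G.Vertex → Part) (w : G.Vertex)
    (hw : G.InZone part w Zone.opposite) : Diagram where
  Vertex := {p : G.Vertex × Zone // G.InZone part p.1 p.2}
  label := fun p q => if p.1.2 = q.1.2 then G.label p.1.1 q.1.1 else none
  sign := fun p => G.sign p.1.1
  token := ⟨(w, Zone.opposite), hw⟩

/-- The result of a tensor move on an edge labelled `A ⊗ B` from the active vertex to `w`: the
three zones, with an edge labelled `A` from the first copy of the active vertex to `w` and an
edge labelled `B` from its second copy to `w` (in normalised form). -/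
noncomputable def splitTensor (G : Diagram) (part : G.Vertex → Part) (w : G.Vertex)
    (hw : G.InZone part w Zone.opposite) (A B : Formula) : Diagram :=
  ((G.zones part w hw).setEdge
      ⟨(G.token, Zone.first), Or.inl rfl⟩ ⟨(w, Zone.opposite), hw⟩ A).setEdge
    ⟨(G.token, Zone.second), Or.inl rfl⟩ ⟨(w, Zone.opposite), hw⟩ B

/-- The moves, with a concrete choice of the vertices of the result. The active vertex is
`G.token`, the passive one is `w`. -/
inductive RawMove (G : Diagram) : Diagram → Prop
  /-- Pass the token along an input edge. -/
  | negative (w : G.Vertex) (A : Formula) (h : G.label w G.token = some A) :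
      RawMove G (G.passTo w)
  /-- On an output `1` that is the sole edge at the active vertex: delete that vertex. -/
  | one (w : G.Vertex) (h : G.label G.token w = some Formula.one)
      (sole : ∀ x, G.skeleton.Adj G.token x → x = w) (hw : w ≠ G.token) :
      RawMove G (G.deleteActive w hw)
  /-- On an output `A ⊗ B`: split the active vertex, both copies keeping `?Θ`. -/
  | tensor (w : G.Vertex) (A B : Formula) (h : G.label G.token w = some (Formula.tensor A B))
      (part : G.Vertex → Part) (hp : G.IsSplitting w part)
      (hw : G.InZone part w Zone.opposite) :
      RawMove G (G.splitTensor part w hw A B)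
  /-- On an output `A ⊕ B`: change the formula into `A`. -/
  | plusLeft (w : G.Vertex) (A B : Formula) (h : G.label G.token w = some (Formula.plus A B)) :
      RawMove G ((G.setEdge G.token w A).passTo w)
  /-- On an output `A ⊕ B`: change the formula into `B`. -/
  | plusRight (w : G.Vertex) (A B : Formula) (h : G.label G.token w = some (Formula.plus A B)) :
      RawMove G ((G.setEdge G.token w B).passTo w)
  /-- On an output `?A^⊥`: for any `n`, replace it by an edge labelled `⊗ⁿ A` in the other
  direction (`n`-ary dereliction). -/
  | whyNot (w : G.Vertex) (A : Formula)
      (h : G.label G.token w = some (Formula.whyNot A.dual)) (n : ℕ) :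
      RawMove G ((G.setEdge w G.token (Formula.tensorPow n A)).passTo w)

end Diagram

/-- Positions of the game. -/
def Position : Type 1 := {G : Diagram // G.IsPosition}

/-- The graph of positions and moves; positions are considered up to isomorphism. -/
def Move (U U' : Position) : Prop :=
  ∃ H : Diagram, U.1.RawMove H ∧ Nonempty (H.Iso U'.1)

/-- A play from `U`: a directed path, finite or infinite, starting at `U` in the graph of
positions and moves. It has `length` moves; the values of `pos k` for `k > length` are
irrelevant. -/
structure Play (U : Position) where
  length : ℕ∞
  pos : ℕ → Position
  start : pos 0 = U
  move : ∀ k : ℕ, (k : ℕ∞) < length → Move (pos k) (pos (k + 1))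

end LLTN

namespace LLTN

/-! ### Duality and the ordinal rank of formulae. -/

namespace Formula

/-! The proof is a reducibility argument. Unfold a position from the token into a rooted tree, given
by the branches at its root; a move then becomes a `Step` between such lists. A tokenless tree is
reducible on a negative edge if play terminates after each answer the other side can give to it, the
new neighbours being reducible in turn; on a positive edge, if play terminates against every tree
reducible on the dual. This is well founded because `rank` places `?A` and `!A` above all tensor
powers of `A`.

The core is `terminates_of_red`: a root whose branches are all reducible terminates. A move replaces
its edge by edges of smaller rank, or, in a negative move, hands the token to a reducible neighbour.
What remains at the old root must again be reducible, which follows by induction on the multiset of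
ranks at the root. Structural induction on trees (`red_kids`) then makes every tree reducible.

Back in graphs, `exists_step_of_move` shows that unfolding simulates moves. Duplication in the
tensor move is handled by projecting copies to their originals: where this is a covering, unfoldings
agree (`Unf.lift`). -/

theorem dual_dual (A : Formula) : A.dual.dual = A := by
  induction A <;> simp_all [dual]

theorem isPositive_dual (A : Formula) : A.dual.isPositive = !A.isPositive := by
  cases A <;> rfl

/-- An ordinal measure of formulae, which decreases along the moves, `?A` being larger than all
tensor powers of `A`. -/
noncomputable def rank : Formula → Ordinal.{0}
  | zero | one | top | bot => 0
  | tensor A B | plus A B | par A B | amp A B => max A.rank B.rank + 1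
  | whyNot A | ofCourse A => A.rank + Ordinal.omega0

theorem rank_dual (A : Formula) : A.dual.rank = A.rank := by
  induction A <;> simp_all [dual, rank]

theorem rank_tensorPow_le (n : ℕ) (A : Formula) : (tensorPow n A).rank ≤ A.rank + n := by
  induction n with
  | zero => simp [tensorPow, rank]
  | succ n ih =>
    rw [tensorPow, rank, Nat.cast_succ, ← add_assoc]
    gcongr
    exact max_le ih le_self_add

theorem rank_tensorPow_lt (n : ℕ) (A : Formula) :
    (tensorPow n A).rank < A.rank + Ordinal.omega0 :=
  (rank_tensorPow_le n A).trans_lt (by gcongr; exact Ordinal.natCast_lt_omega0 n)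

end Formula

open Formula

/-! ### The game on rooted trees and reducibility. -/

/-- Rooted trees whose edges are labelled by formulae, as seen from the parent. -/
inductive Tree : Type
  | node : List (Formula × Tree) → Tree

/-- The branches at the root of a tree, each with the label of its edge. -/
abbrev Kids : Type := List (Formula × Tree)

/-- The branches at the root of a tree. -/
def Tree.kids : Tree → Kids
  | node l => l

/-- The moves on trees rooted at the vertex holding the token; a tree is given by the list of the
branches at its root, up to order. -/
inductive Step : Kids → Kids → Prop
  | negative {l : Kids} (F : Formula) (m r : Kids) (hF : F.isPositive = false)
      (h : l.Perm ((F, .node m) :: r)) : Step l ((F.dual, .node r) :: m)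
  | one (m : Kids) : Step [(.one, .node m)] m
  | tensor {l : Kids} (A B : Formula) (m g th g' : Kids)
      (h : l.Perm ((.tensor A B, .node m) :: (g ++ th ++ g'))) :
      Step l ((A.dual, .node (g ++ th)) :: (B.dual, .node (g' ++ th)) :: m)
  | plusLeft {l : Kids} (A B : Formula) (m r : Kids)
      (h : l.Perm ((.plus A B, .node m) :: r)) : Step l ((A.dual, .node r) :: m)
  | plusRight {l : Kids} (A B : Formula) (m r : Kids)
      (h : l.Perm ((.plus A B, .node m) :: r)) : Step l ((B.dual, .node r) :: m)
  | whyNot {l : Kids} (A : Formula) (n : ℕ) (m r : Kids)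
      (h : l.Perm ((.whyNot A.dual, .node m) :: r)) :
      Step l ((tensorPow n A, .node r) :: m)

/-- All sequences of moves from `l` are finite. -/
def Terminates (l : Kids) : Prop := Acc (fun a b => Step b a) l

/-- Reducibility of a tree without token, of which `m` is the list of branches at the root, on
one more edge at the root, labelled `F` as seen from the root. -/
def Red (F : Formula) (m : Kids) : Prop :=
  match F with
  | .top => True
  | .bot => Terminates m
  | .amp A B =>
    (∀ E, Red A.dual E → Terminates ((A, .node E) :: m)) ∧
      ∀ E, Red B.dual E → Terminates ((B, .node E) :: m)
  | .par A B =>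
    ∀ E E', Red A.dual E → Red B.dual E' → Terminates ((A, .node E) :: (B, .node E') :: m)
  | .ofCourse A =>
    ∀ n E, Red (tensorPow n A).dual E → Terminates ((tensorPow n A, .node E) :: m)
  | .zero => ∀ E, Red .top E → Terminates ((.zero, .node E) :: m)
  | .one => ∀ E, Red .bot E → Terminates ((.one, .node E) :: m)
  | .tensor A B =>
    ∀ E, Red (.par A.dual B.dual) E → Terminates ((.tensor A B, .node E) :: m)
  | .plus A B =>
    ∀ E, Red (.amp A.dual B.dual) E → Terminates ((.plus A B, .node E) :: m)
  | .whyNot A => ∀ E, Red (.ofCourse A.dual) E → Terminates ((.whyNot A, .node E) :: m)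
-- Positive clauses call the dual, of equal rank but negative; negative clauses call only smaller
-- ranks.
termination_by (F.rank, if F.isPositive then 1 else 0)
decreasing_by
  all_goals simp [Prod.lex_def, rank, rank_dual, isPositive, rank_tensorPow_lt]

theorem red_of_isPositive {F : Formula} (hF : F.isPositive = true) (m : Kids) :
    Red F m ↔ ∀ E, Red F.dual E → Terminates ((F, .node E) :: m) := by
  cases F <;> first | exact absurd hF Bool.false_ne_true | (rw [Red]; rfl)

/-- A tree is reducible on an edge as soon as it terminates in all reducible contexts of smaller
rank. -/
theorem red_of_terminates {F : Formula} {r : Kids} {a : Ordinal}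
    (h : ∀ Y : Kids, (∀ e ∈ Y, e.1.rank < a ∧ Red e.1.dual e.2.kids) → Terminates (Y ++ r))
    (hF : F.rank ≤ a) (hF' : F.isPositive = true → F.rank < a) : Red F r := by
  -- Each clause of `Red` tests `r` with at most two extra branches, an instance of `Y`. For
  -- positive `F` the branch carries `F` itself, so its rank must be strictly below `a`; for
  -- negative `F` the labels already have smaller rank.
  have single : ∀ G : Formula, G.rank < a → ∀ E, Red G.dual E → Terminates ((G, .node E) :: r) :=
    fun G hG E hE => h [(G, .node E)] (by simpa using ⟨hG, hE⟩)
  by_cases hp : F.isPositive = true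
  · exact (red_of_isPositive hp r).2 (single F (hF' hp))
  · cases F <;> try exact absurd rfl hp
    case top => rw [Red]; trivial
    case bot => rw [Red]; exact h [] (by simp)
    case par A B =>
      rw [rank, ← Order.succ_eq_add_one, Order.succ_le_iff, max_lt_iff] at hF
      rw [Red]
      exact fun E E' hE hE' => h [(A, .node E), (B, .node E')] (by
        simpa using ⟨⟨hF.1, hE⟩, hF.2, hE'⟩)
    case amp A B =>
      rw [rank, ← Order.succ_eq_add_one, Order.succ_le_iff, max_lt_iff] at hF
      rw [Red]
      exact ⟨single A hF.1, single B hF.2⟩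
    case ofCourse A =>
      rw [Red]
      exact fun n => single _ ((rank_tensorPow_lt n A).trans_le hF)

/-! ### Termination of the game on rooted trees. -/

/-- The ranks of the labels at the root of a tree. -/
noncomputable def ranks (l : Kids) : Multiset Ordinal.{0} := (l.map fun e => e.1.rank : List _)

theorem ranks_append_isDershowitzMannaLT {l Y r s : Kids} {F : Formula} {t : Tree}
    (hl : l.Perm ((F, t) :: (r ++ s))) (hY : ∀ e ∈ Y, e.1.rank < F.rank) :
    (ranks (Y ++ r)).IsDershowitzMannaLT (ranks l) := by
  refine ⟨ranks r, ranks Y, F.rank ::ₘ ranks s, by simp, ?_, ?_, ?_⟩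
  · simp [ranks, add_comm]
  · have : ranks l = ranks ((F, t) :: (r ++ s)) := Multiset.coe_eq_coe.2 (hl.map _)
    rw [this]
    simp [ranks, ← Multiset.cons_coe, ← Multiset.coe_add]
  · intro y hy
    obtain ⟨e, he, rfl⟩ : ∃ e ∈ Y, e.1.rank = y := by simpa [ranks] using hy
    exact ⟨F.rank, by simp, hY e he⟩

/-- Reducibility of the neighbour reached by a move reduces the claim to reducibility of what is
left behind. That is tested by adding edges of rank below the played one, which lowers the multiset
of ranks in the Dershowitz–Manna order. -/
theorem terminates_of_red (l : Kids) (hl : ∀ e ∈ l, Red e.1.dual e.2.kids) : Terminates l := by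
  generalize hM : ranks l = M
  revert l
  refine Multiset.wellFounded_isDershowitzMannaLT.induction
    (C := fun M => ∀ l : Kids, (∀ e ∈ l, Red e.1.dual e.2.kids) → ranks l = M → Terminates l) M ?_
  rintro _ ih l hl rfl
  -- Here `F` is the played edge, `r` the branches kept by one copy of the old root, and `s` those
  -- it loses (nonempty only for tensor).
  have red : ∀ {F G : Formula} {t : Tree} {r s : Kids}, l.Perm ((F, t) :: (r ++ s)) →
      (G.rank < F.rank ∨ G.rank ≤ F.rank ∧ G.isPositive = false) → Red G r := by
    intro F G t r s hp hG
    refine red_of_terminates (a := F.rank) (fun Y hY => ?_) (hG.elim le_of_lt And.left) ?_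
    · refine ih _ (ranks_append_isDershowitzMannaLT hp fun e he => (hY e he).1) _ ?_ rfl
      intro e he
      rcases List.mem_append.1 he with he | he
      · exact (hY e he).2
      · exact hl e (hp.symm.subset (by simp [he]))
    · rintro h
      rcases hG with hG | hG
      · exact hG
      · simp [h] at hG
  have red' : ∀ {F G : Formula} {t : Tree} {r : Kids}, l.Perm ((F, t) :: r) →
      (G.rank < F.rank ∨ G.rank ≤ F.rank ∧ G.isPositive = false) → Red G r :=
    fun {F G t r} hp => red (s := []) (by simpa using hp)
  have head : ∀ {F : Formula} {m r : Kids}, l.Perm ((F, .node m) :: r) → Red F.dual m :=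
    fun {F m r} hp => hl (F, .node m) (hp.symm.subset (by simp))
  refine ⟨_, fun l' hs => ?_⟩
  cases hs with
  | negative F m r hF h =>
    have := head h
    rw [red_of_isPositive (by simp [isPositive_dual, hF]), dual_dual] at this
    exact this r (red' h (.inr ⟨le_rfl, hF⟩))
  | one =>
    have := head (List.Perm.refl _)
    rwa [dual, Red] at this
  | tensor A B m g th g' h =>
    have := head h
    rw [dual, Red] at this
    refine this _ _ ?_ ?_
    · rw [dual_dual]
      exact red h (.inl (by simp [rank]))
    · rw [dual_dual]
      -- Each copy of the root is compared with `l` separately, so having `th` in both copies costs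
      -- nothing.
      refine red (s := g) (h.trans (List.Perm.cons _ ?_)) (.inl (?_ : _ < (Formula.tensor A B).rank))
      · rw [List.append_assoc]
        exact List.perm_append_comm.trans (List.perm_append_comm.append_right _)
      · simp [rank]
  | plusLeft A B m r h =>
    have := head h
    rw [dual, Red] at this
    exact this.1 _ (by rw [dual_dual]; exact red' h (.inl (by simp [rank])))
  | plusRight A B m r h =>
    have := head h
    rw [dual, Red] at this
    exact this.2 _ (by rw [dual_dual]; exact red' h (.inl (by simp [rank])))
  | whyNot A n m r h =>
    have := head h
    rw [dual, dual_dual, Red] at this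
    refine this n _ (red' h (.inl ?_))
    rw [rank_dual, rank, rank_dual]
    exact rank_tensorPow_lt n A

theorem red_kids (t : Tree) (F : Formula) : Red F t.kids := by
  -- The bound `F.rank + 1` meets the strict inequality required for positive `F`.
  refine red_of_terminates (a := F.rank + 1) (fun Y hY => terminates_of_red _ fun e he => ?_)
    le_self_add fun _ => by simp
  rcases List.mem_append.1 he with he | he
  · exact (hY e he).2
  · exact red_kids e.2 e.1.dual
termination_by t
decreasing_by
  obtain ⟨l⟩ := t
  have := List.sizeOf_lt_of_mem he
  obtain ⟨G, u⟩ := e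
  simp [Tree.kids] at this ⊢
  omega

theorem terminates (l : Kids) : Terminates l :=
  terminates_of_red l fun e _ => red_kids e.2 _

/-! ### Unfolding forests, and coverings between graphs. -/

section Unfolding

variable {V W : Type} {N : V → V → Option Formula} {N' : W → W → Option Formula} {ψ : W → V}

/-- `x` and `y` are joined by a path which avoids `v`. -/
def Conn (N : V → V → Option Formula) (v : V) : V → V → Prop :=
  Relation.ReflTransGen fun a b => (N a b).isSome ∧ a ≠ v ∧ b ≠ v

/-- The graph whose edges are given by `N` is simple, undirected and without cycles. -/
structure IsForest (N : V → V → Option Formula) : Prop where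
  symm : ∀ {x y}, (N x y).isSome → (N y x).isSome
  ne : ∀ {x y}, (N x y).isSome → x ≠ y
  eq_of_conn : ∀ {v x y}, (N v x).isSome → (N v y).isSome → Conn N v x y → x = y

theorem Conn.ne_of_ne {v x y : V} (h : Conn N v x y) (hx : x ≠ v) : y ≠ v := by
  induction h with
  | refl => exact hx
  | tail _ h _ => exact h.2.2

/-- A path from `y` avoiding `x` cannot reach `p`: two distinct neighbours of `x` would be connected
off `x`. Hence branches nest. -/
theorem Conn.of_child (hN : IsForest N) {p x y z : V} (hp : (N x p).isSome) (hy : (N x y).isSome)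
    (hyp : y ≠ p) (h : Conn N x y z) : Conn N p x z := by
  induction h with
  | refl => exact .single ⟨hy, hN.ne hp, hyp⟩
  | @tail b c hb hc ih =>
    exact ih.tail ⟨hc.1, ih.ne_of_ne (hN.ne hp),
      fun h => hyp (hN.eq_of_conn hy hp (h ▸ hb.tail hc))⟩

/-- `s` is the list of the branches at the root of the tree obtained by unfolding the graph given
by `N` from the vertex `v`, without returning and without going from `v` to a vertex in `Q`. -/
inductive Unf (N : V → V → Option Formula) : Set V → V → Kids → Prop
  | mk {Q : Set V} {v : V} {s : Kids} (S : Finset V) (f : V → Formula) (k : V → Kids)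
      (mem : ∀ w, w ∈ S ↔ (N v w).isSome ∧ w ∉ Q)
      (label : ∀ w ∈ S, N v w = some (f w))
      (sub : ∀ w ∈ S, Unf N {v} w (k w))
      (eq : (s : Multiset (Formula × Tree)) = S.val.map fun w => (f w, .node (k w))) :
      Unf N Q v s

theorem exists_unf_of_forall [Finite V] {Q : Set V} {v : V}
    (h : ∀ w, (N v w).isSome → w ∉ Q → ∃ t, Unf N {v} w t) : ∃ s, Unf N Q v s := by
  classical
  have := Fintype.ofFinite V
  choose! k hk using h
  refine ⟨_, .mk (Finset.univ.filter fun w => (N v w).isSome ∧ w ∉ Q) (fun w => (N v w).getD .one)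
    k (by simp) ?_ ?_ (Multiset.coe_toList _)⟩
  · intro w hw
    obtain ⟨F, hF⟩ := Option.isSome_iff_exists.1 (Finset.mem_filter.1 hw).2.1
    simp [hF]
  · intro w hw
    exact hk w (Finset.mem_filter.1 hw).2.1 (Finset.mem_filter.1 hw).2.2

theorem IsForest.exists_unf [Finite V] (hN : IsForest N) (v : V) : ∃ s, Unf N ∅ v s := by
  have branch : ∀ n p x, (N x p).isSome → {z | Conn N p x z}.ncard = n → ∃ t, Unf N {p} x t := by
    intro n
    induction n using Nat.strong_induction_on with
    | _ n ih =>
    rintro p x hp rfl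
    refine exists_unf_of_forall fun y hy hyp => ih _ ?_ x y (hN.symm hy) rfl
    -- The child's branch is strictly smaller, since it misses `x`.
    refine Set.ncard_lt_ncard ⟨fun z hz => Conn.of_child hN hp hy hyp hz, fun h => ?_⟩
      (Set.toFinite _)
    exact (h (Relation.ReflTransGen.refl : Conn N p x x)).ne_of_ne (hN.ne hy).symm rfl
  exact exists_unf_of_forall fun w hw _ => branch _ v w (hN.symm hw) rfl

/-- Used to attach an edge created or relabelled by a move, after unfolding the rest of the new root
with that edge excluded. -/
theorem Unf.insert {Q : Set V} {v w : V} {F : Formula} {m r : Kids}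
    (hm : Unf N (insert v Q) w m) (hr : Unf N {w} v r) (h : N w v = some F) (hv : v ∉ Q) :
    Unf N Q w ((F, .node r) :: m) := by
  classical
  obtain ⟨S, f, k, mem, label, sub, eq⟩ := hm
  have hvS : v ∉ S := by simp [mem]
  have hne : ∀ u ∈ S, u ≠ v := fun u hu h => hvS (h ▸ hu)
  refine ⟨S.cons v hvS, Function.update f v F, Function.update k v r, ?_, ?_, ?_, ?_⟩
  · intro u
    rw [Finset.mem_cons, mem]
    by_cases hu : u = v
    · simp [hu, h, hv]
    · simp [hu]
  · intro u hu
    rcases Finset.mem_cons.1 hu with rfl | hu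
    · simpa using h
    · simpa [Function.update_of_ne (hne u hu)] using label u hu
  · intro u hu
    rcases Finset.mem_cons.1 hu with rfl | hu
    · simpa using hr
    · simpa [Function.update_of_ne (hne u hu)] using sub u hu
  · rw [← Multiset.cons_coe, eq, Finset.cons_val, Multiset.map_cons]
    simp only [Function.update_self]
    congr 1
    refine Multiset.map_congr rfl fun u hu => ?_
    rw [Function.update_of_ne (hne u hu), Function.update_of_ne (hne u hu)]

/-- `ψ` restricts to a bijection, compatible with the labels, from the neighbours of `x` outside
of `Q` onto `T`. -/
structure IsLocalLift (N : V → V → Option Formula) (N' : W → W → Option Formula) (ψ : W → V)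
    (x : W) (Q : Set W) (T : Set V) : Prop where
  map : ∀ z, (N' x z).isSome → z ∉ Q → ψ z ∈ T ∧ N (ψ x) (ψ z) = N' x z
  surj : ∀ z ∈ T, ∃ z', (N' x z').isSome ∧ z' ∉ Q ∧ ψ z' = z
  inj : ∀ z z', (N' x z).isSome → (N' x z').isSome → z ∉ Q → z' ∉ Q → ψ z = ψ z' → z = z'

theorem IsLocalLift.unf {x : W} {Q : Set W} {T : Finset V} {f : V → Formula} {k : V → Kids}
    {s : Kids} (h : IsLocalLift N N' ψ x Q T)
    (label : ∀ z ∈ T, N (ψ x) z = some (f z))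
    (sub : ∀ z, (N' x z).isSome → z ∉ Q → Unf N' {x} z (k (ψ z)))
    (eq : (s : Multiset (Formula × Tree)) = T.val.map fun w => (f w, .node (k w))) :
    Unf N' Q x s := by
  classical
  have : Nonempty W := ⟨x⟩
  choose! φ hφ₁ hφ₂ hφ₃ using h.surj
  have hmem : ∀ w, w ∈ T.image φ ↔ (N' x w).isSome ∧ w ∉ Q := by
    intro w
    rw [Finset.mem_image]
    constructor
    · rintro ⟨z, hz, rfl⟩
      exact ⟨hφ₁ z hz, hφ₂ z hz⟩
    · rintro ⟨h₁, h₂⟩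
      have hw := (h.map w h₁ h₂).1
      exact ⟨ψ w, hw, h.inj _ _ (hφ₁ _ hw) h₁ (hφ₂ _ hw) h₂ (hφ₃ _ hw)⟩
  refine ⟨T.image φ, f ∘ ψ, k ∘ ψ, hmem, ?_, ?_, ?_⟩
  · intro w hw
    obtain ⟨h₁, h₂⟩ := (hmem w).1 hw
    rw [← (h.map w h₁ h₂).2]
    exact label _ (h.map w h₁ h₂).1
  · intro w hw
    exact sub w ((hmem w).1 hw).1 ((hmem w).1 hw).2
  · have hinj : Set.InjOn φ T := fun a ha b hb hab => by rw [← hφ₃ a ha, hab, hφ₃ b hb]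
    rw [Finset.image_val_of_injOn hinj, Multiset.map_map, eq]
    refine Multiset.map_congr rfl fun u hu => ?_
    simp [hφ₃ u hu]

/-- `ψ` is a covering at `x`. -/
def IsCoveringAt (N : V → V → Option Formula) (N' : W → W → Option Formula) (ψ : W → V)
    (x : W) : Prop :=
  IsLocalLift N N' ψ x ∅ {z | (N (ψ x) z).isSome}

/-- Local bijectivity matches children with children at each stage, the parent being the only
neighbour over its image. The covering condition is needed only over the branch, which lets it fail
where a move changes the graph. -/
theorem Unf.lift (hN : IsForest N) {p x : W} {s : Kids} (h : Unf N {ψ p} (ψ x) s)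
    (hp : (N' x p).isSome) (symm : ∀ y z, (N' y z).isSome → (N' z y).isSome)
    (cov : ∀ y, Conn N (ψ p) (ψ x) (ψ y) → IsCoveringAt N N' ψ y) : Unf N' {p} x s := by
  generalize hQ : ({ψ p} : Set V) = Q at h
  generalize hv : ψ x = v at h
  induction h generalizing p x with
  | @mk Q v s S f k mem label sub eq ih =>
  subst hv hQ
  have hx := cov x .refl
  have hpx : (N (ψ x) (ψ p)).isSome := by rw [(hx.map p hp (by simp)).2]; exact hp
  have hne : ∀ z, (N' x z).isSome → z ≠ p → ψ z ≠ ψ p :=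
    fun z hz hzp h => hzp (hx.inj z p hz hp (by simp) (by simp) h)
  have hS : ∀ z, (N' x z).isSome → z ≠ p → ψ z ∈ S := fun z hz hzp =>
    (mem _).2 ⟨by rw [(hx.map z hz (by simp)).2]; exact hz, hne z hz hzp⟩
  refine IsLocalLift.unf (ψ := ψ) (T := S) ⟨?_, ?_, ?_⟩ label ?_ eq
  · exact fun z hz hzp => ⟨hS z hz hzp, (hx.map z hz (by simp)).2⟩
  · intro z hz
    obtain ⟨h₁, h₂⟩ := (mem z).1 hz
    obtain ⟨z', hz', -, rfl⟩ := hx.surj z h₁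
    exact ⟨z', hz', fun h => h₂ (congrArg ψ h), rfl⟩
  · exact fun z z' hz hz' _ _ => hx.inj z z' hz hz' (by simp) (by simp)
  · intro z hz hzp
    refine ih _ (hS z hz hzp) (symm _ _ hz) (fun y hy => cov y ?_) rfl rfl
    exact Conn.of_child hN hpx ((mem _).1 (hS z hz hzp)).1 (hne z hz hzp) hy

/-- Unfold from `x` some branches at `ψ x`. -/
theorem IsLocalLift.unf_of_covering (hN : IsForest N) {x : W} {Q : Set W} {T : Finset V}
    {f : V → Formula} {k : V → Kids} {s : Kids} (h : IsLocalLift N N' ψ x Q T)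
    (label : ∀ z ∈ T, N (ψ x) z = some (f z)) (sub : ∀ z ∈ T, Unf N {ψ x} z (k z))
    (symm : ∀ y z, (N' y z).isSome → (N' z y).isSome)
    (cov : ∀ z ∈ T, ∀ y, Conn N (ψ x) z (ψ y) → IsCoveringAt N N' ψ y)
    (eq : (s : Multiset (Formula × Tree)) = T.val.map fun w => (f w, .node (k w))) :
    Unf N' Q x s :=
  h.unf label (fun z hz hzQ => (sub _ (h.map z hz hzQ).1).lift hN (symm _ _ hz) symm
    (cov _ (h.map z hz hzQ).1)) eq

theorem IsForest.of_equiv (hN' : IsForest N') (e : V ≃ W) (he : ∀ x y, N' (e x) (e y) = N x y) :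
    IsForest N where
  symm h := by rw [← he] at h ⊢; exact hN'.symm h
  ne h := by rw [← he] at h; exact fun h' => hN'.ne h (congrArg e h')
  eq_of_conn h₁ h₂ h := by
    rw [← he] at h₁ h₂
    refine e.injective (hN'.eq_of_conn h₁ h₂ (h.lift e fun a b hab => ?_))
    simpa [Function.onFun, he] using hab

theorem Unf.of_equiv (hN : IsForest N) (e : V ≃ W) (he : ∀ x y, N' (e x) (e y) = N x y)
    {x : V} {s : Kids} (h : Unf N ∅ x s) : Unf N' ∅ (e x) s := by
  obtain ⟨S, f, k, mem, label, sub, eq⟩ := h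
  have he' : ∀ x y, N (e.symm x) (e.symm y) = N' x y := fun x y => by rw [← he]; simp
  have cov : ∀ y, IsCoveringAt N N' e.symm y := fun y =>
    ⟨fun z hz _ => ⟨by simpa [he'] using hz, he' y z⟩,
      fun z hz => ⟨e z, by simpa [← he'] using hz, by simp, by simp⟩,
      fun z z' _ _ _ _ h => e.symm.injective h⟩
  have hS : (S : Set V) = {z | (N x z).isSome} := by ext z; simp [mem]
  refine IsLocalLift.unf_of_covering (ψ := e.symm) (T := S) hN ?_ (by simpa using label)
    (by simpa using sub) (fun y z h => ?_) (fun _ _ y _ => cov y) eq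
  · rw [hS]
    simpa [IsCoveringAt] using cov (e x)
  · rw [← he'] at h ⊢
    exact hN.symm h

/-- Replace the label of the edge between the root `v` and `w`, and pass the root to `w`. -/
theorem Unf.update_edge {N' : V → V → Option Formula} (hN : IsForest N) {v w : V} {F G : Formula}
    {s : Kids} (h : Unf N ∅ v s) (hF : N v w = some F)
    (hvw : (N' v w).isSome) (hwv : N' w v = some G)
    (hN' : ∀ x y, ¬(x = v ∧ y = w) → ¬(x = w ∧ y = v) → N' x y = N x y) :
    ∃ m r : Kids, s.Perm ((F, .node m) :: r) ∧ Unf N' ∅ w ((G, .node r) :: m) := by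
  classical
  obtain ⟨S, f, k, mem, label, sub, eq⟩ := h
  have hvw₀ : (N v w).isSome := by simp [hF]
  have hwv₀ := hN.symm hvw₀
  have hw : w ∈ S := (mem w).2 ⟨hvw₀, by simp⟩
  have hne : v ≠ w := hN.ne hvw₀
  have symm : ∀ y z, (N' y z).isSome → (N' z y).isSome := by
    intro y z h
    by_cases h₁ : y = v ∧ z = w
    · simp [h₁, hwv]
    by_cases h₂ : y = w ∧ z = v
    · simpa [h₂] using hvw
    rw [hN' _ _ (by tauto) (by tauto)]
    rw [hN' _ _ h₁ h₂] at h
    exact hN.symm h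
  -- The identity is a covering off the ends of the changed edge, and no branch on either side of
  -- that edge contains these ends.
  have cov : ∀ y, y ≠ v → y ≠ w → IsCoveringAt N N' id y := by
    intro y h₁ h₂
    have h₃ : ∀ z, N' y z = N y z := fun z => hN' y z (by tauto) (by tauto)
    exact ⟨fun z hz _ => ⟨by simpa [h₃] using hz, (h₃ z).symm⟩,
      fun z hz => ⟨z, by simpa [h₃] using hz, by simp, rfl⟩, fun z z' _ _ _ _ h => h⟩
  refine ⟨k w, ((S.erase w).val.map fun w => (f w, Tree.node (k w))).toList, ?_, ?_⟩
  · rw [← Multiset.coe_eq_coe, eq, ← Multiset.cons_coe, Multiset.coe_toList, Finset.erase_val]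
    have := label w hw
    rw [hF, Option.some_inj] at this
    rw [this, ← Multiset.map_cons (fun w => (f w, Tree.node (k w))), Multiset.cons_erase hw]
  · refine Unf.insert (v := v) ?_ ?_ hwv (by simp)
    · obtain ⟨Sw, fw, kw, memw, labelw, subw, eqw⟩ := sub w hw
      refine IsLocalLift.unf_of_covering (ψ := id) (T := Sw) hN ⟨?_, ?_, ?_⟩ labelw subw symm ?_ eqw
      · intro z hz hzv
        have hzv : z ≠ v := by simpa using hzv
        have h₃ : N' w z = N w z := hN' w z (by tauto) (by tauto)
        exact ⟨(memw z).2 ⟨h₃ ▸ hz, by simpa using hzv⟩, h₃.symm⟩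
      · intro z hz
        obtain ⟨h₁, h₂⟩ := (memw z).1 hz
        have hzv : z ≠ v := by simpa using h₂
        exact ⟨z, by rwa [hN' w z (by tauto) (by tauto)], by simpa using hzv, rfl⟩
      · exact fun z z' _ _ _ _ h => h
      · intro z hz y hy
        obtain ⟨h₁, h₂⟩ := (memw z).1 hz
        exact cov y ((Conn.of_child hN hwv₀ h₁ h₂ hy).ne_of_ne hne.symm)
          (hy.ne_of_ne (hN.ne h₁).symm)
    · refine IsLocalLift.unf_of_covering (ψ := id) (T := S.erase w) (f := f) (k := k) hN
        ⟨?_, ?_, ?_⟩ (fun z hz => label z (Finset.mem_of_mem_erase hz))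
        (fun z hz => sub z (Finset.mem_of_mem_erase hz)) symm ?_ (Multiset.coe_toList _)
      · intro z hz hzw
        have hzw : z ≠ w := by simpa using hzw
        have h₃ : N' v z = N v z := hN' v z (by tauto) (by tauto)
        exact ⟨by simpa [mem, hzw, h₃] using hz, h₃.symm⟩
      · intro z hz
        obtain ⟨hzw, hz⟩ := Finset.mem_erase.1 hz
        exact ⟨z, by rw [hN' v z (by tauto) (by tauto)]; exact ((mem z).1 hz).1, hzw, rfl⟩
      · exact fun z z' _ _ _ _ h => h
      · intro z hz y hy
        obtain ⟨hzw, hz⟩ := Finset.mem_erase.1 hz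
        have h₁ := ((mem z).1 hz).1
        exact cov y (hy.ne_of_ne (hN.ne h₁).symm)
          ((Conn.of_child hN hvw₀ h₁ hzw hy).ne_of_ne hne)

end Unfolding

/-! ### Positions as forests. -/

namespace Diagram

/-- The label of the edge between `x` and `y`, as seen from `x`. -/
def view (G : Diagram) (x y : G.Vertex) : Option Formula :=
  (G.label x y).or ((G.label y x).map dual)

theorem view_isSome_symm (G : Diagram) (x y : G.Vertex) (h : (G.view x y).isSome) :
    (G.view y x).isSome := by
  simpa [view, or_comm] using h

theorem view_of_label {G : Diagram} {x y : G.Vertex} {A : Formula} (h : G.label x y = some A) :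
    G.view x y = some A := by
  simp [view, h]

theorem IsPosition.label_self {G : Diagram} (hG : G.IsPosition) (x : G.Vertex) :
    G.label x x = none := by
  by_contra h
  exact h (hG.oneWay x x (Option.isSome_iff_ne_none.2 h))

theorem IsPosition.adj_iff {G : Diagram} (hG : G.IsPosition) {x y : G.Vertex} :
    G.skeleton.Adj x y ↔ (G.view x y).isSome := by
  rw [skeleton, SimpleGraph.fromRel_adj]
  constructor
  · rintro ⟨-, h⟩
    simpa [view] using h
  · intro h
    refine ⟨?_, by simpa [view] using h⟩
    rintro rfl
    simp [view, hG.label_self] at h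

theorem IsPosition.view_of_label_swap {G : Diagram} (hG : G.IsPosition) {x y : G.Vertex}
    {A : Formula} (h : G.label y x = some A) : G.view x y = some A.dual := by
  simp [view, h, hG.oneWay y x (by simp [h])]

/-- A path from `x` to `y` off `v`, prolonged by the edge from `v` to `x`, must be the one-edge path
from `v` to `y`, by uniqueness of paths in a tree. -/
theorem IsPosition.isForest {G : Diagram} (hG : G.IsPosition) : IsForest G.view where
  symm := G.view_isSome_symm _ _
  ne h := (hG.adj_iff.2 h).ne
  eq_of_conn := by
    classical
    intro v x y hx hy h
    rw [← hG.adj_iff] at hx hy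
    obtain ⟨p, hp⟩ : ∃ p : G.skeleton.Walk x y, v ∉ p.support := by
      clear hx
      induction h using Relation.ReflTransGen.head_induction_on with
      | refl => exact ⟨.nil, by simpa using hy.ne⟩
      | @head a b hab _ ih =>
        obtain ⟨q, hq⟩ := ih
        exact ⟨.cons (hG.adj_iff.2 hab.1) q, by simpa [hq] using hab.2.1.symm⟩
    have h₁ : v ∉ p.bypass.support := fun h => hp (p.support_bypass_subset_support h)
    have := (hG.tree.isAcyclic.subsingleton_path v y).elim
      ⟨.cons hx p.bypass, p.bypass_isPath.cons h₁⟩ ⟨.cons hy .nil, by simp [hy.ne]⟩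
    rw [Subtype.mk.injEq, SimpleGraph.Walk.cons.injEq] at this
    exact this.1

end Diagram

/-! ### Effect of the moves on unfoldings. -/

namespace Diagram

open Classical in
theorem view_setEdge {G : Diagram} {a b : G.Vertex} (hab : a ≠ b) (F : Formula) (x y : G.Vertex) :
    (G.setEdge a b F).view x y =
      if x = a ∧ y = b then some F else if x = b ∧ y = a then some F.dual else G.view x y := by
  unfold view setEdge
  by_cases h₁ : x = a ∧ y = b
  · obtain ⟨rfl, rfl⟩ := h₁
    cases hF : F.isPositive <;> simp [hab, hab.symm, dual_dual]
  by_cases h₂ : x = b ∧ y = a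
  · obtain ⟨rfl, rfl⟩ := h₂
    cases hF : F.isPositive <;> simp [hab, hab.symm]
  have h₁' : ¬(y = b ∧ x = a) := fun h => h₁ h.symm
  have h₂' : ¬(y = a ∧ x = b) := fun h => h₂ h.symm
  simp [h₁, h₂, h₁', h₂']

open Classical in
theorem view_zones (G : Diagram) (part : G.Vertex → Part) (w : G.Vertex)
    (hw : G.InZone part w .opposite) (p q : (G.zones part w hw).Vertex) :
    (G.zones part w hw).view p q = if p.1.2 = q.1.2 then G.view p.1.1 q.1.1 else none := by
  unfold view zones
  by_cases h : p.1.2 = q.1.2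
  · simp [h]
  · simp [h, Ne.symm h]

theorem view_setEdge_of_ne {G : Diagram} {a b : G.Vertex} (hab : a ≠ b) (F : Formula)
    {x y : G.Vertex} (h₁ : ¬(x = a ∧ y = b)) (h₂ : ¬(x = b ∧ y = a)) :
    (G.setEdge a b F).view x y = G.view x y := by
  classical rw [view_setEdge hab, if_neg h₁, if_neg h₂]

/-- The deleted vertex is a leaf attached to `w`, so the inclusion of the remaining vertices is a
covering off `w`. -/
theorem unf_deleteActive {G : Diagram} (hG : G.IsPosition) {w : G.Vertex} {F : Formula} {s : Kids}
    (h : G.view G.token w = some F) (sole : ∀ x, G.skeleton.Adj G.token x → x = w)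
    (hw : w ≠ G.token) (hs : Unf G.view ∅ G.token s) :
    ∃ m, s = [(F, .node m)] ∧
      Unf (G.deleteActive w hw).view ∅ (G.deleteActive w hw).token m := by
  obtain ⟨S, f, k, mem, label, sub, eq⟩ := hs
  have hF := hG.isForest
  have hvw : (G.view G.token w).isSome := by simp [h]
  have hwS : w ∈ S := (mem w).2 ⟨hvw, by simp⟩
  have hS : S = {w} := by
    ext x
    rw [Finset.mem_singleton]
    exact ⟨fun hx => sole x (hG.adj_iff.2 ((mem x).1 hx).1), fun hx => hx ▸ hwS⟩
  have hfw := label w hwS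
  rw [h, Option.some_inj] at hfw
  refine ⟨k w, ?_, ?_⟩
  · rw [hS, Finset.singleton_val, Multiset.map_singleton, Multiset.coe_eq_singleton] at eq
    rw [eq, hfw]
  obtain ⟨Sw, fw, kw, memw, labelw, subw, eqw⟩ := sub w hwS
  refine IsLocalLift.unf_of_covering (ψ := Subtype.val) (x := ⟨w, hw⟩) (T := Sw) hF
    ⟨?_, ?_, fun z z' _ _ _ _ h => Subtype.ext h⟩ labelw subw
    (view_isSome_symm (G.deleteActive w hw)) ?_ eqw
  · exact fun z hz _ => ⟨(memw _).2 ⟨hz, z.2⟩, rfl⟩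
  · intro z hz
    obtain ⟨h₁, h₂⟩ := (memw z).1 hz
    exact ⟨⟨z, h₂⟩, h₁, Set.notMem_empty _, rfl⟩
  · intro z hz y hy
    obtain ⟨h₁, h₂⟩ := (memw z).1 hz
    refine ⟨fun z hz _ => ⟨hz, rfl⟩, fun z hz => ⟨⟨z, ?_⟩, hz, Set.notMem_empty _, rfl⟩,
      fun z z' _ _ _ _ h => Subtype.ext h⟩
    rintro rfl
    exact hy.ne_of_ne (hF.ne h₁).symm (sole _ (hG.adj_iff.2 (hF.symm hz)))

open Classical in
theorem view_splitTensor (G : Diagram) (part : G.Vertex → Part) (w : G.Vertex)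
    (hw : G.InZone part w .opposite) (A B : Formula)
    (p q : {p : G.Vertex × Zone // G.InZone part p.1 p.2}) :
    (G.splitTensor part w hw A B).view p q =
      if p.1 = (G.token, .second) ∧ q.1 = (w, .opposite) then some B
      else if p.1 = (w, .opposite) ∧ q.1 = (G.token, .second) then some B.dual
      else if p.1 = (G.token, .first) ∧ q.1 = (w, .opposite) then some A
      else if p.1 = (w, .opposite) ∧ q.1 = (G.token, .first) then some A.dual
      else if p.1.2 = q.1.2 then G.view p.1.1 q.1.1 else none := by
  have h₁ : ∀ ζ, ζ ≠ Zone.opposite → ∀ h, (⟨(G.token, ζ), h⟩ : (G.zones part w hw).Vertex) ≠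
      ⟨(w, .opposite), hw⟩ := fun ζ hζ h e => hζ (congrArg (fun p => p.1.2) e)
  refine (view_setEdge (G := (G.zones part w hw).setEdge ⟨(G.token, .first), .inl rfl⟩
    ⟨(w, .opposite), hw⟩ A) (h₁ .second (by simp) _) B p q).trans ?_
  refine if_congr (and_congr Subtype.ext_iff Subtype.ext_iff) rfl
    (if_congr (and_congr Subtype.ext_iff Subtype.ext_iff) rfl ?_)
  refine (view_setEdge (G := G.zones part w hw) (h₁ .first (by simp) _) A p q).trans ?_
  exact if_congr (and_congr Subtype.ext_iff Subtype.ext_iff) rfl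
    (if_congr (and_congr Subtype.ext_iff Subtype.ext_iff) rfl (view_zones G part w hw p q))

/-- A tensor move on the unfolding. -/
theorem unf_splitTensor {G : Diagram} (hG : G.IsPosition) {w : G.Vertex} {F A B : Formula}
    {s : Kids} (h : G.view G.token w = some F) {part : G.Vertex → Part}
    (hp : G.IsSplitting w part) (hw : G.InZone part w .opposite) (hs : Unf G.view ∅ G.token s) :
    ∃ m g th g' : Kids, s.Perm ((F, .node m) :: (g ++ th ++ g')) ∧
      Unf (G.splitTensor part w hw A B).view ∅ (G.splitTensor part w hw A B).token
        ((A.dual, .node (g ++ th)) :: (B.dual, .node (g' ++ th)) :: m) := by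
  classical
  obtain ⟨S, f, k, mem, label, sub, eq⟩ := hs
  have hF := hG.isForest
  have hvw : (G.view G.token w).isSome := by simp [h]
  have hne : G.token ≠ w := hF.ne hvw
  have hwS : w ∈ S := (mem w).2 ⟨hvw, by simp⟩
  have hfw := label w hwS
  rw [h, Option.some_inj] at hfw
  have hpw : part w = .delta := hw.2
  have symm := view_isSome_symm (G.splitTensor part w hw A B)
  have hview := view_splitTensor G part w hw A B
  generalize hN' : (G.splitTensor part w hw A B).view = N' at symm hview ⊢
  clear hN'
  change {p : G.Vertex × Zone // G.InZone part p.1 p.2} →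
    {p : G.Vertex × Zone // G.InZone part p.1 p.2} → Option Formula at N'
  let w' : {p : G.Vertex × Zone // G.InZone part p.1 p.2} := ⟨(w, .opposite), hw⟩
  let v₁ : {p : G.Vertex × Zone // G.InZone part p.1 p.2} := ⟨(G.token, .first), Or.inl rfl⟩
  let v₂ : {p : G.Vertex × Zone // G.InZone part p.1 p.2} := ⟨(G.token, .second), Or.inl rfl⟩
  let ψ : {p : G.Vertex × Zone // G.InZone part p.1 p.2} → G.Vertex := fun p => p.1.1
  change ∃ m g th g' : Kids, _ ∧ Unf N' ∅ w' _
  have same : ∀ p q, p.1.2 = q.1.2 → N' p q = G.view (ψ p) (ψ q) := by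
    rintro ⟨⟨x, ζ⟩, hx⟩ ⟨⟨y, ζ'⟩, hy⟩ rfl
    rw [hview]
    cases ζ <;> simp [ψ]
  have diff : ∀ p q, (N' p q).isSome → p.1.2 = q.1.2 ∨
      (p = w' ∧ (q = v₁ ∨ q = v₂)) ∨ (q = w' ∧ (p = v₁ ∨ p = v₂)) := by
    intro p q hpq
    rw [hview] at hpq
    split_ifs at hpq with h₁ h₂ h₃ h₄ h₅
    · exact .inr (.inr ⟨Subtype.ext h₁.2, .inr (Subtype.ext h₁.1)⟩)
    · exact .inr (.inl ⟨Subtype.ext h₂.1, .inr (Subtype.ext h₂.2)⟩)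
    · exact .inr (.inr ⟨Subtype.ext h₃.2, .inl (Subtype.ext h₃.1)⟩)
    · exact .inr (.inl ⟨Subtype.ext h₄.1, .inl (Subtype.ext h₄.2)⟩)
    · exact .inl h₅
    · simp at hpq
  have hψ : ∀ p q, p.1.2 = q.1.2 → ψ p = ψ q → p = q :=
    fun p q h₁ h₂ => Subtype.ext (Prod.ext h₂ h₁)
  have ne_of_zone_ne : ∀ p q : {p : G.Vertex × Zone // G.InZone part p.1 p.2},
      p.1.2 ≠ q.1.2 → p ≠ q := fun p q h e => h (e ▸ rfl)
  -- Off the copies of the active vertex and `w`, no new edge occurs, and every neighbour has a copy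
  -- in the same zone: `Δ` meets the active vertex only through `w`.
  have cov : ∀ p, ψ p ≠ G.token → ψ p ≠ w → IsCoveringAt G.view N' ψ p := by
    intro p h₁ h₂
    have hsame : ∀ q, (N' p q).isSome → p.1.2 = q.1.2 := by
      intro q hq
      rcases diff p q hq with h | ⟨rfl, -⟩ | ⟨-, rfl | rfl⟩
      exacts [h, absurd rfl h₂, absurd rfl h₁, absurd rfl h₁]
    refine ⟨fun z hz _ => ?_, fun z hz => ?_, fun z z' hz hz' _ _ h =>
      hψ z z' ((hsame z hz).symm.trans (hsame z' hz')) h⟩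
    · have := same p z (hsame z hz)
      exact ⟨by simpa [← this] using hz, this.symm⟩
    · have hz : (G.view (ψ p) z).isSome := hz
      have hzone : G.InZone part z p.1.2 := by
        by_cases hzv : z = G.token
        · subst hzv
          have := hp.delta_iff _ (hG.adj_iff.2 (hF.symm hz))
          obtain ⟨⟨x, ζ⟩, hx⟩ := p
          cases ζ
          · exact .inl rfl
          · exact .inl rfl
          · exact absurd (this.1 hx.2) h₂
        · have := hp.closed _ _ h₁ hzv (hG.adj_iff.2 hz)
          obtain ⟨⟨x, ζ⟩, hx⟩ := p
          change part x = part z at this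
          change x ≠ G.token at h₁
          cases ζ <;> simpa [InZone, hzv, h₁, this] using hx
      refine ⟨⟨(z, p.1.2), hzone⟩, ?_, by simp, rfl⟩
      rwa [same p ⟨(z, p.1.2), hzone⟩ rfl]
  -- Both copies of the active vertex are treated at once. The branches retained are those in the
  -- zone `ζ`; none contains `w`, which lies in `Δ`.
  have copy : ∀ ζ, ζ ≠ Zone.opposite → ∀ hv : G.InZone part G.token ζ, ∀ s' : Kids,
      (s' : Multiset (Formula × Tree)) = (S.filter fun x => G.InZone part x ζ).val.map
        (fun x => (f x, .node (k x))) → Unf N' {w'} ⟨(G.token, ζ), hv⟩ s' := by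
    intro ζ hζ hv s' hs'
    have hsame : ∀ q, (N' ⟨(G.token, ζ), hv⟩ q).isSome → q ≠ w' → ζ = q.1.2 := by
      intro q hq hqw
      rcases diff _ q hq with h | ⟨h, -⟩ | ⟨h, -⟩
      · exact h
      · exact absurd (congrArg (fun p => p.1.2) h) hζ
      · exact absurd h hqw
    refine IsLocalLift.unf_of_covering (ψ := ψ) hF ⟨?_, ?_, ?_⟩
      (fun z hz => label z (Finset.mem_filter.1 hz).1)
      (fun z hz => sub z (Finset.mem_filter.1 hz).1) symm ?_ hs'
    · intro z hz hzw
      have hzζ := hsame z hz hzw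
      have := same ⟨(G.token, ζ), hv⟩ z hzζ
      rw [this] at hz
      refine ⟨Finset.mem_filter.2 ⟨(mem _).2 ⟨hz, by simp⟩, ?_⟩, this.symm⟩
      rw [hzζ]
      exact z.2
    · intro z hz
      obtain ⟨h₁, h₂⟩ := Finset.mem_filter.1 hz
      refine ⟨⟨(z, ζ), h₂⟩, ?_, fun h => hζ (congrArg (fun p => p.1.2) h), rfl⟩
      rw [same ⟨(G.token, ζ), hv⟩ ⟨(z, ζ), h₂⟩ rfl]
      exact ((mem z).1 h₁).1
    · exact fun z z' hz hz' h h' => hψ z z' ((hsame z hz h).symm.trans (hsame z' hz' h'))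
    · intro z hz y hy
      obtain ⟨h₁, h₂⟩ := Finset.mem_filter.1 hz
      have h₁ := ((mem z).1 h₁).1
      refine cov y (hy.ne_of_ne (hF.ne h₁).symm) fun hyw => ?_
      rw [hyw] at hy
      rw [hF.eq_of_conn h₁ hvw hy] at h₂
      cases ζ
      · simp [InZone, hpw, hne.symm] at h₂
      · simp [InZone, hpw, hne.symm] at h₂
      · exact hζ rfl
  obtain ⟨Sw, fw, kw, memw, labelw, subw, eqw⟩ := sub w hwS
  -- With both new edges excluded, the passive vertex unfolds as `w` did with the active vertex as
  -- parent.
  have root : Unf N' {v₁, v₂} w' (k w) := by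
    have hsame : ∀ q, (N' w' q).isSome → q ∉ ({v₁, v₂} : Set _) → Zone.opposite = q.1.2 := by
      intro q hq hqv
      rcases diff _ q hq with h | ⟨-, h⟩ | ⟨-, h⟩
      · exact h
      · exact absurd h hqv
      · rcases h with h | h
        exacts [absurd h (ne_of_zone_ne _ _ (by simp [w', v₁])),
          absurd h (ne_of_zone_ne _ _ (by simp [w', v₂]))]
    refine IsLocalLift.unf_of_covering (ψ := ψ) (T := Sw) hF ⟨?_, ?_, ?_⟩ labelw subw symm ?_ eqw
    · intro z hz hzv
      have hzζ := hsame z hz hzv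
      have := same w' z hzζ
      rw [this] at hz
      have hin := z.2
      rw [← hzζ] at hin
      exact ⟨(memw _).2 ⟨hz, hin.1⟩, this.symm⟩
    · intro z hz
      obtain ⟨h₁, h₂⟩ := (memw z).1 hz
      have h₂ : z ≠ G.token := h₂
      have := hp.closed _ _ hne.symm h₂ (hG.adj_iff.2 h₁)
      refine ⟨⟨(z, .opposite), h₂, this ▸ hpw⟩, ?_, ?_, rfl⟩
      · rwa [same w' ⟨(z, .opposite), h₂, this ▸ hpw⟩ rfl]
      · rintro (h | h)
        exacts [ne_of_zone_ne _ _ (by simp [v₁]) h, ne_of_zone_ne _ _ (by simp [v₂]) h]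
    · exact fun z z' hz hz' h h' => hψ z z' ((hsame z hz h).symm.trans (hsame z' hz' h'))
    · intro z hz y hy
      obtain ⟨h₁, h₂⟩ := (memw z).1 hz
      exact cov y ((Conn.of_child hF (hF.symm hvw) h₁ h₂ hy).ne_of_ne hne.symm)
        (hy.ne_of_ne (hF.ne h₁).symm)
  let branches : Part → Multiset (Formula × Tree) :=
    fun a => (S.filter fun x => part x = a).val.map fun x => (f x, .node (k x))
  have hvS : G.token ∉ S := fun h => hF.ne ((mem _).1 h).1 rfl
  have hSv : ∀ x ∈ S, x ≠ G.token := fun x hx h => hvS (h ▸ hx)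
  have hpart : ∀ x ∈ S, (part x = .delta ↔ x = w) := fun x hx =>
    hp.delta_iff x (hG.adj_iff.2 ((mem x).1 hx).1)
  have union : ∀ a b, a ≠ b → branches a + branches b =
      (S.filter fun x => part x = a ∨ part x = b).val.map fun x => (f x, .node (k x)) := by
    intro a b hab
    have hd : Disjoint (S.filter fun x => part x = a) (S.filter fun x => part x = b) :=
      Finset.disjoint_filter.2 fun x _ h₁ h₂ => hab (h₁.symm.trans h₂)
    rw [Finset.filter_or, ← Finset.disjUnion_eq_union _ _ hd]
    exact (Multiset.map_add _ _ _).symm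
  have zone : ∀ ζ, ζ ≠ Zone.opposite → ∀ a, a ≠ Part.theta →
      (∀ x, G.InZone part x ζ ↔ x = G.token ∨ part x = a ∨ part x = .theta) →
      branches a + branches .theta =
        (S.filter fun x => G.InZone part x ζ).val.map fun x => (f x, .node (k x)) := by
    intro ζ _ a ha h
    rw [union a .theta ha]
    congr 2
    exact Finset.filter_congr fun x hx => by simp [h, hSv x hx]
  refine ⟨k w, (branches .gamma).toList, (branches .theta).toList, (branches .gamma').toList,
    ?_, ?_⟩
  · rw [← Multiset.coe_eq_coe, eq, ← Multiset.cons_coe, ← Multiset.coe_add, ← Multiset.coe_add]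
    simp only [Multiset.coe_toList]
    have hd : Disjoint (S.filter fun x => part x = .gamma ∨ part x = .theta)
        (S.filter fun x => part x = .gamma') :=
      Finset.disjoint_filter.2 fun x _ h₁ h₂ => by simp [h₂] at h₁
    -- By `delta_iff`, every neighbour of the active vertex other than `w` lies in one of the three
    -- parts on its side.
    have hS : S.erase w = Finset.disjUnion _ _ hd := by
      ext x
      simp only [Finset.mem_erase, Finset.mem_disjUnion, Finset.mem_filter]
      by_cases hx : x ∈ S
      · rw [Ne, ← hpart x hx]
        cases part x <;> simp [hx]
      · simp [hx]
    rw [union _ _ (by simp), ← Multiset.cons_erase (show w ∈ S.val from hwS), ← Finset.erase_val,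
      hS, Multiset.map_cons, hfw]
    congr 1
    exact Multiset.map_add _ _ _
  · refine Unf.insert (v := v₁) (Unf.insert (v := v₂) ?_ ?_ ?_ ?_) ?_ ?_ (by simp)
    · rwa [insert_empty_eq, Set.pair_comm]
    · refine copy .second (by simp) _ _ ?_
      rw [← Multiset.coe_add, Multiset.coe_toList, Multiset.coe_toList]
      exact zone .second (by simp) _ (by simp) fun x => Iff.rfl
    · rw [hview]; simp [w', v₂]
    · rw [Set.mem_insert_iff, not_or]
      exact ⟨ne_of_zone_ne _ _ (by simp [v₁, v₂]), Set.notMem_empty _⟩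
    · refine copy .first (by simp) _ _ ?_
      rw [← Multiset.coe_add, Multiset.coe_toList, Multiset.coe_toList]
      exact zone .first (by simp) _ (by simp) fun x => Iff.rfl
    · rw [hview]; simp [w', v₁]

theorem exists_step_of_rawMove {G H : Diagram} (hG : G.IsPosition) {s : Kids}
    (hs : Unf G.view ∅ G.token s) (h : G.RawMove H) :
    ∃ s', Step s s' ∧ Unf H.view ∅ H.token s' := by
  have hF := hG.isForest
  cases h with
  | negative w A h =>
    have h' := hG.view_of_label_swap h
    obtain ⟨m, r, hm, hr⟩ := hs.update_edge hF h' (by simp [h']) (view_of_label h)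
      (fun _ _ _ _ => rfl)
    refine ⟨_, .negative A.dual m r ?_ hm, ?_⟩
    · simp [isPositive_dual, hG.normal _ _ _ h]
    · rwa [dual_dual]
  | one w h sole hw =>
    obtain ⟨m, rfl, hm⟩ := unf_deleteActive hG (view_of_label h) sole hw hs
    exact ⟨m, .one m, hm⟩
  | tensor w A B h part hp hw =>
    obtain ⟨m, g, th, g', hm, hr⟩ :=
      unf_splitTensor (A := A) (B := B) hG (view_of_label h) hp hw hs
    exact ⟨_, .tensor A B m g th g' hm, hr⟩
  | plusLeft w A B h =>
    have h' := view_of_label h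
    have hne : G.token ≠ w := hF.ne (by simp [h'])
    obtain ⟨m, r, hm, hr⟩ := hs.update_edge (N' := (G.setEdge G.token w A).view) (G := A.dual) hF h'
      (by simp [view_setEdge hne]) (by simp [view_setEdge hne, hne.symm])
      (fun x y h₁ h₂ => view_setEdge_of_ne hne _ (by tauto) (by tauto))
    exact ⟨_, .plusLeft A B m r hm, hr⟩
  | plusRight w A B h =>
    have h' := view_of_label h
    have hne : G.token ≠ w := hF.ne (by simp [h'])
    obtain ⟨m, r, hm, hr⟩ := hs.update_edge (N' := (G.setEdge G.token w B).view) (G := B.dual) hF h'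
      (by simp [view_setEdge hne]) (by simp [view_setEdge hne, hne.symm])
      (fun x y h₁ h₂ => view_setEdge_of_ne hne _ (by tauto) (by tauto))
    exact ⟨_, .plusRight A B m r hm, hr⟩
  | whyNot w A h n =>
    have h' := view_of_label h
    have hne : w ≠ G.token := (hF.ne (by simp [h'])).symm
    obtain ⟨m, r, hm, hr⟩ := hs.update_edge (N' := (G.setEdge w G.token (tensorPow n A)).view)
      (G := tensorPow n A) hF h'
      (by simp [view_setEdge hne, hne.symm]) (by simp [view_setEdge hne])
      (fun x y h₁ h₂ => view_setEdge_of_ne hne _ (by tauto) (by tauto))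
    exact ⟨_, .whyNot A n m r hm, hr⟩

end Diagram

/-! ### Simulation of plays by steps, and conclusion. -/

theorem exists_step_of_move {U U' : Position} (h : Move U U') {s : Kids}
    (hs : Unf U.1.view ∅ U.1.token s) :
    ∃ s', Step s s' ∧ Unf U'.1.view ∅ U'.1.token s' := by
  obtain ⟨H, hH, ⟨e⟩⟩ := h
  obtain ⟨s', hs', hu⟩ := Diagram.exists_step_of_rawMove U.2 hs hH
  refine ⟨s', hs', ?_⟩
  have he : ∀ x y, U'.1.view (e.toEquiv x) (e.toEquiv y) = H.view x y := fun x y => by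
    simp [Diagram.view, e.label_eq]
  -- That the raw result `H` is a forest is pulled back from the position `U'` along the
  -- isomorphism, rather than proved for each move.
  have := hu.of_equiv (U'.2.isForest.of_equiv e.toEquiv he) e.toEquiv he
  rwa [e.token_eq] at this

theorem not_forall_move {s : Kids} (hs : Terminates s) (pos : ℕ → Position)
    (h₀ : Unf (pos 0).1.view ∅ (pos 0).1.token s) : ¬∀ k, Move (pos k) (pos (k + 1)) := by
  induction hs generalizing pos with
  | intro s _ ih =>
    intro h
    obtain ⟨s', hs', hu⟩ := exists_step_of_move (h 0) h₀
    exact ih s' hs' (fun k => pos (k + 1)) hu fun k => h (k + 1)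

end LLTN

theorem mainTheorem3 (U : LLTN.Position) (p : LLTN.Play U) : p.length < ⊤ := by
  rw [lt_top_iff_ne_top]
  intro h
  have := (p.pos 0).2.finite
  obtain ⟨s, hs⟩ := (p.pos 0).2.isForest.exists_unf (p.pos 0).1.token
  exact LLTN.not_forall_move (LLTN.terminates s) p.pos hs fun k => p.move k (by simp [h])
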